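/- Let $X$ be a proper geodesic metric space with a base point $o \in X$, and let $G$ be a group acting on $X$ properly and by isometries. \emph{Contracting elements.} A closed subset $Y \subset X$ is contracting if there is $\alpha > 0$ such that for every geodesic $\gamma$ with $d(\gamma, Y) \geq \alpha$ the set of nearest-point projections on $Y$ of the points of $\gamma$ has diameter at most $\alpha$. An element $g \in G$ is contracting if for some (equivalently, every) $y \in X$ the orbit map $\mathbb{Z} \to X$, $n \mapsto g^n y$, is a quasi-isometric embedding with contracting image. \emph{Horocompactification.} A cocycle on $X$ is a continuous map $c \colon X \times X \to \mathbb{R}$ with $c(x,z) = c(x,y) + c(y,z)$ for all $x,y,z \in X$; the space of cocycles carries the topology of uniform convergence on compact sets. The horocompactification $\bar X$ is the closure, in the space of cocycles, of the set of the cocycles $b_z(x,y) = d(x,z) - d(y,z)$, $z \in X$. It is endowed with its Borel $\sigma$-algebra, and $G$ acts on it by $(gc)(x,y) = c(g^{-1}x, g^{-1}y)$. \emph{Densities.} Let $\omega \geq 0$. An $\omega$-conformal density is a family $\nu = (\nu_x)_{x \in X}$ of finite positive Borel measures on $\bar X$ with $\nu_x \ll \nu_y$ for all $x,y \in X$, normalized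 by $\|\nu_o\| = 1$ (where $\|\cdot\|$ denotes the total mass), and such that for all $x,y \in X$, $$\frac{d\nu_x}{d\nu_y}(c) = e^{-\omega c(x,y)} \quad \text{for } \nu_y\text{-almost every } c.$$ For a subgroup $H$ of $G$, the density is $H$-invariant if $h_*\nu_x = \nu_{hx}$ for all $h \in H$ and $x \in X$. \emph{Shadows.} For $x,y \in X$ and $r \geq 0$, the $r$-shadow of $y$ seen from $x$ is $$\mathcal{O}_x(y,r) = \left\{ c \in \bar X : \tfrac12\left[d(x,y) + c(y,x)\right] \leq r \right\}.$$ For $\epsilon > 0$ and $r_0 \geq 0$, the pair $(G,\nu)$ satisfies the Shadow Principle with parameters $(\epsilon, r_0)$ if $\nu_o(\mathcal{O}_o(go,r)) \geq \epsilon \|\nu_{go}\| e^{-\omega d(o,go)}$ for all $g \in G$ and $r \geq r_0$. \textbf{Corollary (Shadow Lemma).} Assume that $G$ is not virtually cyclic and contains a contracting element. Let $N$ be an infinite normal subgroup of $G$ and let $\omega \geq 0$. There exist $\epsilon > 0$ and $r_0 \geq 0$ such that for every $r \geq r_0$, every $N$-invariant $\omega$-conformal density $\nu = (\nu_x)$ and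 every $g \in G$, $$\epsilon \,\|\nu_{go}\|\, e^{-\omega d(o,go)} \;\leq\; \nu_o\big(\mathcal{O}_o(go,r)\big) \;\leq\; e^{2\omega r}\, \|\nu_{go}\|\, e^{-\omega d(o,go)}.$$ In particular, $(G,\nu)$ satisfies the Shadow Principle with parameters $(\epsilon, r_0)$. -/

import Mathlib

open MeasureTheory

noncomputable section

/-! ### Geodesics and contracting elements -/

section Contracting

variable {X : Type*} [MetricSpace X]

/-- `γ` restricted to the interval `I` is a geodesic. -/
def IsGeodesicPath (I : Set ℝ) (γ : ℝ → X) : Prop :=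
  I.OrdConnected ∧ ∀ t ∈ I, ∀ t' ∈ I, dist (γ t) (γ t') = |t' - t|

/-- Any two points are joined by a (not necessarily unique) geodesic. -/
def IsGeodesicMetricSpace (X : Type*) [MetricSpace X] : Prop :=
  ∀ x y : X, ∃ γ : ℝ → X, IsGeodesicPath (Set.Icc 0 (dist x y)) γ ∧
    γ 0 = x ∧ γ (dist x y) = y

/-- The set of nearest point projections on `Y` of the points of `Z`. -/
def nearestProj (Y Z : Set X) : Set X :=
  {y | y ∈ Y ∧ ∃ z ∈ Z, ∀ y' ∈ Y, dist z y ≤ dist z y'}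

/-- `Y` is closed and every geodesic at distance at least `α` from `Y` has a projection on `Y`
of diameter at most `α`. The conditions on the distance between two sets and on the diameter are
written pointwise, so that no convention for empty or unbounded sets intervenes. -/
def IsContractingWith (α : ℝ) (Y : Set X) : Prop :=
  IsClosed Y ∧ ∀ (I : Set ℝ) (γ : ℝ → X), IsGeodesicPath I γ →
    (∀ z ∈ γ '' I, ∀ y ∈ Y, α ≤ dist z y) →
    ∀ p ∈ nearestProj Y (γ '' I), ∀ q ∈ nearestProj Y (γ '' I), dist p q ≤ α

/-- A contracting set. -/
def IsContractingSet (Y : Set X) : Prop := ∃ α : ℝ, 0 < α ∧ IsContractingWith α Y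

/-- `u : ℤ → X` is a quasi-isometric embedding. -/
def IsQuasiIsometricEmbeddingInt (u : ℤ → X) : Prop :=
  ∃ K C : ℝ, 1 ≤ K ∧ 0 ≤ C ∧ ∀ m n : ℤ,
    K⁻¹ * |(m : ℝ) - n| - C ≤ dist (u m) (u n) ∧ dist (u m) (u n) ≤ K * |(m : ℝ) - n| + C

/-- `g` is a contracting element for its action on `X`: some orbit map `n ↦ g ^ n • y` is a
quasi-isometric embedding with contracting image. For proper isometric actions on proper geodesic
spaces this does not depend on `y`. -/
def IsContractingElement (X : Type*) [MetricSpace X] {G : Type*} [Group G] [MulAction G X]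
    (g : G) : Prop :=
  ∃ y : X, IsQuasiIsometricEmbeddingInt (fun n : ℤ => g ^ n • y) ∧
    IsContractingSet (Set.range fun n : ℤ => g ^ n • y)

end Contracting

/-- `G` has a cyclic subgroup of finite index. -/
def IsVirtuallyCyclicGroup (G : Type*) [Group G] : Prop :=
  ∃ H : Subgroup G, IsCyclic H ∧ H.FiniteIndex

/-! ### The horocompactification -/

section Horo

/-- The continuous cocycles on `X`, that is the continuous functions modulo constants, a function
`f` corresponding to the cocycle `(x, y) ↦ f x - f y`. The topology is that of uniform convergence
on compact sets (the compact-open topology of `C(X × X, ℝ)`). -/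
abbrev ContCocycle (X : Type*) [MetricSpace X] : Type _ :=
  {c : C(X × X, ℝ) // ∀ x y z : X, c (x, z) = c (x, y) + c (y, z)}

/-- The cocycle `b_z (x, y) = d(x, z) - d(y, z)`. -/
def pointCocycle {X : Type*} [MetricSpace X] (z : X) : ContCocycle X :=
  ⟨⟨fun p => dist p.1 z - dist p.2 z, by fun_prop⟩, fun x y w => by simp⟩

/-- The horocompactification of `X`: the closure of the image of `X` in the space of cocycles. -/
def Horocompactification (X : Type*) [MetricSpace X] : Type _ :=
  {c : ContCocycle X // c ∈ closure (Set.range (pointCocycle (X := X)))}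

variable {X : Type*} [MetricSpace X]

instance : TopologicalSpace (Horocompactification X) :=
  inferInstanceAs (TopologicalSpace
    {c : ContCocycle X // c ∈ closure (Set.range (pointCocycle (X := X)))})

/-- The horocompactification carries its Borel sigma-algebra. -/
instance : MeasurableSpace (Horocompactification X) := borel _

instance : BorelSpace (Horocompactification X) := ⟨rfl⟩

/-- The value `c(x, y)` of a point `c` of the horocompactification, seen as a cocycle. -/
def Horocompactification.eval (c : Horocompactification X) (x y : X) : ℝ := c.1.1 (x, y)

variable {G : Type*} [Group G] [MulAction G X] [IsIsometricSMul G X]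

/-- Translation of cocycles: `(g c)(x, y) = c(g⁻¹ x, g⁻¹ y)`. -/
def ContCocycle.translate (g : G) (c : ContCocycle X) : ContCocycle X :=
  ⟨c.1.comp ⟨fun p => (g⁻¹ • p.1, g⁻¹ • p.2), by fun_prop⟩, fun x y z => by
    simpa using c.2 (g⁻¹ • x) (g⁻¹ • y) (g⁻¹ • z)⟩

theorem ContCocycle.continuous_translate (g : G) :
    Continuous (ContCocycle.translate g : ContCocycle X → ContCocycle X) := by
  apply Continuous.subtype_mk
  exact (ContinuousMap.continuous_precomp _).comp continuous_subtype_val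

theorem ContCocycle.translate_pointCocycle (g : G) (z : X) :
    ContCocycle.translate g (pointCocycle z) = pointCocycle (g • z) := by
  apply Subtype.ext
  ext p
  have h : ∀ x : X, dist (g⁻¹ • x) z = dist x (g • z) := fun x => by
    rw [← dist_smul g (g⁻¹ • x) z, smul_inv_smul]
  simp [ContCocycle.translate, pointCocycle, h]

/-- The action of `G` on the horocompactification, which extends the action on `X`. -/
instance : SMul G (Horocompactification X) where
  smul g c := ⟨ContCocycle.translate g c.1,
    map_mem_closure (ContCocycle.continuous_translate g) c.2 (by
      rintro _ ⟨z, rfl⟩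
      exact ⟨g • z, (ContCocycle.translate_pointCocycle g z).symm⟩)⟩

theorem Horocompactification.measurable_smul (g : G) :
    Measurable (fun c : Horocompactification X => g • c) := by
  apply Continuous.measurable
  apply Continuous.subtype_mk
  exact (ContCocycle.continuous_translate g).comp continuous_subtype_val

end Horo

/-! ### Densities and shadows -/

section Density

variable {X : Type*} [MetricSpace X]

/-- A density on the horocompactification with its Borel sigma-algebra, normalized at `o`. -/
structure IsDensity (o : X) (ν : X → Measure (Horocompactification X)) : Prop where
  finite : ∀ x, IsFiniteMeasure (ν x)
  absolutelyContinuous : ∀ x y, ν x ≪ ν y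
  normalized : ν o Set.univ = 1

/-- An `ω`-conformal density, normalized at `o`. -/
structure IsConformalDensity (o : X) (ω : ℝ) (ν : X → Measure (Horocompactification X)) : Prop
    extends IsDensity o ν where
  conformal : ∀ x y, (ν x).rnDeriv (ν y) =ᵐ[ν y]
    fun c => ENNReal.ofReal (Real.exp (-ω * c.eval x y))

/-- `h_* ν_x = ν_{h x}` for every `h ∈ H` and every `x`. -/
def IsInvariantDensity {G : Type*} [Group G] [MulAction G X] [IsIsometricSMul G X]
    (H : Subgroup G) (ν : X → Measure (Horocompactification X)) : Prop :=
  ∀ h ∈ H, ∀ x : X, (ν x).map (fun c => h • c) = ν (h • x)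

/-- The Gromov product of `x` and `c` seen from `y`: half of `d(x, y) + c(y, x)`. -/
def horoGromovProduct (x : X) (c : Horocompactification X) (y : X) : ℝ :=
  (1 / 2) * (dist x y + c.eval y x)

/-- The `r`-shadow of `y` seen from `x`. -/
def horoShadow (x y : X) (r : ℝ) : Set (Horocompactification X) :=
  {c | horoGromovProduct x c y ≤ r}

/-- The pair `(G, ν)` satisfies the Shadow Principle (for the exponent `ω` and the base point `o`)
with parameters `(ε, r₀)`. -/
def SatisfiesShadowPrinciple (G : Type*) [Group G] [MulAction G X] (o : X) (ω : ℝ)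
    (ν : X → Measure (Horocompactification X)) (ε r₀ : ℝ) : Prop :=
  ∀ (g : G) (r : ℝ), r₀ ≤ r →
    ε * (ν (g • o)).real Set.univ * Real.exp (-ω * dist o (g • o)) ≤
      (ν o).real (horoShadow o (g • o) r)

end Density

end

/-!
# The Shadow Lemma for normal subgroups

The lower bound comes from a covering argument. Suppose that a finite set `F ⊆ N` has the property
that for all `z`, `w` in `X` some `f ∈ F` satisfies `d(z, o) + d(o, f w) ≤ d(z, f w) + r`, that is,
a geodesic from `z` to `f w` passes near `o` (`exists_finite_extension`). By density of `X` in the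
horocompactification the same holds with a cocycle `c` instead of `w`
(`exists_smul_mem_horoShadow`): every `c` is sent by some `f ∈ F` into the shadow of `o` seen from
`z`. Conjugating by `g`, finitely many translates of the shadow of `g o` seen from `o` by elements of
`N` cover the horocompactification. By invariance and conformality these translates have comparable
masses for `ν (g o)`, with constants which only depend on the displacement of `o` by `F`, so the
shadow has a definite proportion of the mass of `ν (g o)`; changing `g o` into `o` costs a factor at
most `exp (ω d(o, g o))`. The upper bound follows from conformality alone, since
`c(o, g o) ≥ d(o, g o) - 2 r` on the shadow.

To construct `F`, let `A` be an orbit of `⟨g⟩` for a contracting element `g`. Contraction is only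
used through `HasStrongProj`: points with distant projections on `A` are joined most economically
through these projections. This yields the Behrstock inequality (`HasStrongProj.behrstock`). If
`n ∈ N` is such that `A` and `n A` have bounded projections on each other, then any point, up to
moving it by `1` or `n⁻¹`, projects on `A` near the base point, and the elements
`m₁⁻¹ g ^ k n g ^ (-k) m₂` of `N` with `m₁, m₂ ∈ {1, n⁻¹}` and `k` large have the required property.

Such an `n` exists because an element `u` for which the projection of `u A` on `A` is large
satisfies, by the pigeonhole principle, a relation `u g ^ b u⁻¹ = g ^ a` with `a` and `b` nonzero and
bounded by a constant `M` (`exists_isBoundedCommensurator_of_not_hasBoundedProj`). Comparing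
translation lengths gives `|a| = |b|`, so `u` normalizes `⟨g ^ M !⟩`, and such elements `u` lie in
finitely many cosets of this cyclic group (`exists_finset_coset_cover`). If all elements of `N` were
of this kind, the infinite normal subgroup `N` would contain a nontrivial power of `g`, all
elements of `G` would be of this kind, and `G` would be virtually cyclic
(`exists_mem_hasBoundedProj`).
-/

/-! ### Nearest point projections -/

section Projection

open scoped Pointwise

variable {X : Type*} [MetricSpace X]

/-- `p` is a nearest point projection of `x` on `Y`. -/
def IsNearestPt (Y : Set X) (x p : X) : Prop := p ∈ Y ∧ ∀ y ∈ Y, dist x p ≤ dist x y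

theorem isNearestPt_self {Y : Set X} {y : X} (hy : y ∈ Y) : IsNearestPt Y y y :=
  ⟨hy, fun z _ => by simp⟩

theorem IsNearestPt.smul {G : Type*} [Group G] [MulAction G X] [IsIsometricSMul G X]
    {Y : Set X} {x p : X} (h : IsNearestPt Y x p) (u : G) :
    IsNearestPt (u • Y) (u • x) (u • p) := by
  refine ⟨Set.smul_mem_smul_set h.1, ?_⟩
  rintro _ ⟨y, hy, rfl⟩
  simpa using h.2 y hy

theorem IsNearestPt.inv_smul {G : Type*} [Group G] [MulAction G X] [IsIsometricSMul G X]
    {Y : Set X} {x p : X} {u : G} (h : IsNearestPt (u • Y) x p) :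
    IsNearestPt Y (u⁻¹ • x) (u⁻¹ • p) := by
  simpa using h.smul u⁻¹

theorem IsNearestPt.infDist_eq {Y : Set X} {x p : X} (h : IsNearestPt Y x p) :
    Metric.infDist x Y = dist x p :=
  le_antisymm (Metric.infDist_le_dist_of_mem h.1)
    ((Metric.le_infDist ⟨p, h.1⟩).2 fun {y} hy => h.2 y hy)

theorem exists_isNearestPt [ProperSpace X] {Y : Set X} (hY : IsClosed Y) (hne : Y.Nonempty)
    (x : X) : ∃ p, IsNearestPt Y x p := by
  obtain ⟨p, hp, h⟩ := hY.exists_infDist_eq_dist hne x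
  exact ⟨p, hp, fun y hy => h ▸ Metric.infDist_le_dist_of_mem hy⟩

/-- The geometric content of contraction: whenever two points have projections on `Y` more than
`C` apart, going from one to the other through these projections is as short as possible up to an
error `C`. The existence of projections is part of the definition. -/
structure HasStrongProj (C : ℝ) (Y : Set X) : Prop where
  exists_pt : ∀ x, ∃ p, IsNearestPt Y x p
  dist_le : ∀ {x y p q : X}, IsNearestPt Y x p → IsNearestPt Y y q → C < dist p q →
    dist x p + dist p q + dist q y ≤ dist x y + C

theorem IsGeodesicPath.continuousOn {I : Set ℝ} {γ : ℝ → X} (h : IsGeodesicPath I γ) :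
    ContinuousOn γ I := by
  apply LipschitzOnWith.continuousOn (K := 1)
  refine LipschitzOnWith.of_dist_le_mul fun t ht s hs => ?_
  rw [h.2 t ht s hs, Real.dist_eq, abs_sub_comm]
  simp

/-- A geodesic from `x` to `y` first meets the `α`-neighbourhood of `Y` near the projection `p`
of `x`: before that time its projection has diameter at most `α`. -/
theorem IsContractingWith.dist_add_dist_le [ProperSpace X] (hX : IsGeodesicMetricSpace X)
    {α : ℝ} (hα : 0 < α) {Y : Set X} (hY : IsContractingWith α Y) {x y p q : X}
    (hp : IsNearestPt Y x p) (hq : IsNearestPt Y y q) (h : α < dist p q) :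
    dist x p + dist p y ≤ dist x y + 4 * α := by
  obtain hxp | hxp := le_or_gt (dist x p) α
  · have := dist_triangle_left p y x
    linarith
  obtain ⟨γ, hγ, h0, h1⟩ := hX x y
  set D := dist x y with hD
  have hD0 : 0 ≤ D := dist_nonneg
  have hne : Y.Nonempty := ⟨p, hp.1⟩
  have hcont : ContinuousOn (fun t => Metric.infDist (γ t) Y) (Set.Icc 0 D) :=
    (Metric.continuous_infDist_pt Y).comp_continuousOn hγ.continuousOn
  -- the times at which the geodesic is `α`-close to `Y`
  set Z : Set ℝ := Set.Icc 0 D ∩ (fun t => Metric.infDist (γ t) Y) ⁻¹' Set.Iic α with hZ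
  have hZc : IsCompact Z := isCompact_Icc.of_isClosed_subset
    (hcont.preimage_isClosed_of_isClosed isClosed_Icc isClosed_Iic) Set.inter_subset_left
  have hZne : Z.Nonempty := by
    by_contra hemp
    have hfar : ∀ z ∈ γ '' Set.Icc 0 D, ∀ y ∈ Y, α ≤ dist z y := by
      rintro _ ⟨t, ht, rfl⟩ y hy
      by_contra! hlt
      exact hemp ⟨t, ht, (Metric.infDist_le_dist_of_mem hy).trans hlt.le⟩
    have := hY.2 _ γ hγ hfar p ⟨hp.1, x, ⟨0, ⟨le_rfl, hD0⟩, h0⟩, hp.2⟩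
      q ⟨hq.1, y, ⟨D, ⟨hD0, le_rfl⟩, h1⟩, hq.2⟩
    linarith
  obtain ⟨t, ⟨⟨ht0, htD⟩, htα⟩, hleast⟩ := hZc.exists_isLeast hZne
  have hsub : Set.Icc 0 t ⊆ Set.Icc 0 D := Set.Icc_subset_Icc_right htD
  have hge : ∀ s ∈ Set.Icc 0 t, α ≤ Metric.infDist (γ s) Y := by
    intro s hs
    by_contra! hlt
    have h0α : α ≤ Metric.infDist (γ 0) Y := by rw [h0, hp.infDist_eq]; exact hxp.le
    obtain ⟨s', hs', hs'α⟩ := intermediate_value_Icc' hs.1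
      (hcont.mono ((Set.Icc_subset_Icc_right hs.2).trans hsub)) ⟨hlt.le, h0α⟩
    have hts : t ≤ s' := hleast ⟨hsub ⟨hs'.1, hs'.2.trans hs.2⟩, hs'α.le⟩
    have : s' = s := le_antisymm hs'.2 (hs.2.trans hts)
    subst this
    exact hlt.ne hs'α
  obtain ⟨p', hp'⟩ := exists_isNearestPt hY.1 hne (γ t)
  have hpp' : dist p p' ≤ α := by
    refine hY.2 (Set.Icc 0 t) γ ⟨Set.ordConnected_Icc, fun a ha b hb =>
      hγ.2 a (hsub ha) b (hsub hb)⟩ ?_ p ⟨hp.1, x, ⟨0, ⟨le_rfl, ht0⟩, h0⟩, hp.2⟩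
      p' ⟨hp'.1, γ t, ⟨t, ⟨ht0, le_rfl⟩, rfl⟩, hp'.2⟩
    rintro _ ⟨s, hs, rfl⟩ y hy
    exact (hge s hs).trans (Metric.infDist_le_dist_of_mem hy)
  have hp'α : dist (γ t) p' ≤ α := by rw [← hp'.infDist_eq]; exact htα
  have e1 : dist x (γ t) = t := by
    rw [← h0, hγ.2 0 ⟨le_rfl, hD0⟩ t ⟨ht0, htD⟩]; simp [abs_of_nonneg ht0]
  have e2 : dist (γ t) y = D - t := by
    rw [← h1, hγ.2 t ⟨ht0, htD⟩ D ⟨hD0, le_rfl⟩, abs_of_nonneg (by linarith)]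
  have h3 : dist (γ t) p ≤ 2 * α := by
    have := dist_triangle_right (γ t) p p'
    linarith
  have h4 := dist_triangle x (γ t) p
  have h5 := dist_triangle_left p y (γ t)
  linarith

theorem IsContractingWith.hasStrongProj [ProperSpace X] (hX : IsGeodesicMetricSpace X)
    {α : ℝ} (hα : 0 < α) {Y : Set X} (hne : Y.Nonempty) (hY : IsContractingWith α Y) :
    HasStrongProj (8 * α) Y := by
  refine ⟨exists_isNearestPt hY.1 hne, fun {x y p q} hp hq h => ?_⟩
  have h1 := hY.dist_add_dist_le hX hα hp hq (by linarith)
  have h2 := hY.dist_add_dist_le hX hα hq (isNearestPt_self hp.1) (by rw [dist_comm]; linarith)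
  rw [dist_comm y q, dist_comm q p, dist_comm y p] at h2
  linarith

namespace HasStrongProj

theorem smul {G : Type*} [Group G] [MulAction G X] [IsIsometricSMul G X] {C : ℝ} {Y : Set X}
    (h : HasStrongProj C Y) (u : G) : HasStrongProj C (u • Y) := by
  refine ⟨fun x => ?_, fun {x y p q} hp hq hpq => ?_⟩
  · obtain ⟨p, hp⟩ := h.exists_pt (u⁻¹ • x)
    exact ⟨u • p, by simpa using hp.smul u⟩
  · simpa using h.dist_le hp.inv_smul hq.inv_smul (by simpa using hpq)

variable {C : ℝ} {Y : Set X}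

theorem dist_add_dist_le_of_mem (h : HasStrongProj C Y) {x y p : X} (hp : IsNearestPt Y x p)
    (hy : y ∈ Y) : dist x p + dist p y ≤ dist x y + C := by
  obtain h1 | h1 := le_or_gt (dist p y) C
  · linarith [hp.2 y hy]
  · simpa using h.dist_le hp (isNearestPt_self hy) h1

/-- `Y` is quasiconvex: a point which is almost between two points of `Y` is close to `Y`. -/
theorem two_mul_dist_add_dist_le (h : HasStrongProj C Y) {x y p q : X} (hx : x ∈ Y) (hy : y ∈ Y)
    (hq : IsNearestPt Y p q) : 2 * dist p q + dist x y ≤ dist p x + dist p y + 2 * C := by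
  have h1 := h.dist_add_dist_le_of_mem hq hx
  have h2 := h.dist_add_dist_le_of_mem hq hy
  have h3 := dist_triangle_left x y q
  linarith

/-- The Behrstock inequality: the projections of a point `x` on two sets cannot both be far away
from the projection of the other set. -/
theorem behrstock {Y₁ Y₂ : Set X} (h₁ : HasStrongProj C Y₁) (h₂ : HasStrongProj C Y₂)
    {x p₁ p₂ q₁ q₂ : X} (hp₁ : IsNearestPt Y₁ x p₁) (hp₂ : IsNearestPt Y₂ x p₂)
    (hq₁ : IsNearestPt Y₁ p₂ q₁) (hq₂ : IsNearestPt Y₂ p₁ q₂) :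
    dist p₁ q₁ ≤ C ∨ dist p₂ q₂ ≤ C := by
  by_contra! hcon
  have e1 := h₁.dist_le hp₁ hq₁ hcon.1
  have e2 := h₂.dist_le hp₂ hq₂ hcon.2
  have := dist_nonneg (x := q₁) (y := p₂)
  have := dist_nonneg (x := q₂) (y := p₁)
  linarith

end HasStrongProj

end Projection

/-! ### Extension of geodesics by finitely many elements -/

section Extension

open scoped Pointwise

variable {X : Type*} {G : Type*} [Group G] [MulAction G X]

/-- The orbit of `x` under the cyclic group generated by `g`. -/
def cyclicOrbit (g : G) (x : X) : Set X := Set.range fun n : ℤ => g ^ n • x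

theorem zpow_smul_mem_cyclicOrbit (g : G) (x : X) (n : ℤ) : g ^ n • x ∈ cyclicOrbit g x := ⟨n, rfl⟩

theorem zpow_smul_cyclicOrbit (g : G) (x : X) (n : ℤ) :
    g ^ n • cyclicOrbit g x = cyclicOrbit g x := by
  ext y
  rw [Set.mem_smul_set_iff_inv_smul_mem]
  constructor
  · rintro ⟨m, hm⟩
    refine ⟨n + m, ?_⟩
    simp only at hm
    simp [zpow_add, mul_smul, hm]
  · rintro ⟨m, rfl⟩
    exact ⟨-n + m, by simp [zpow_add, mul_smul]⟩

variable [MetricSpace X]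

/-- The projection on the orbit of `⟨g⟩` of its translate by `u` has diameter at most `L`. -/
def HasBoundedProj (g : G) (x₀ : X) (L : ℝ) (u : G) : Prop :=
  ∀ x ∈ u • cyclicOrbit g x₀, ∀ y ∈ u • cyclicOrbit g x₀, ∀ p q,
    IsNearestPt (cyclicOrbit g x₀) x p → IsNearestPt (cyclicOrbit g x₀) y q → dist p q ≤ L

theorem HasBoundedProj.exists_dist_le {g : G} {x₀ : X} {L C : ℝ} {u : G}
    (hA : HasStrongProj C (cyclicOrbit g x₀)) (h : HasBoundedProj g x₀ L u) :
    ∃ B, ∀ x ∈ u • cyclicOrbit g x₀, ∀ p, IsNearestPt (cyclicOrbit g x₀) x p → dist x₀ p ≤ B := by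
  obtain ⟨p₀, hp₀⟩ := hA.exists_pt (u • x₀)
  have hx₀ : u • x₀ ∈ u • cyclicOrbit g x₀ :=
    Set.smul_mem_smul_set ⟨0, by simp⟩
  refine ⟨dist x₀ p₀ + L, fun x hx p hp => ?_⟩
  have := h _ hx₀ _ hx _ _ hp₀ hp
  have := dist_triangle x₀ p₀ p
  linarith

variable [IsIsometricSMul G X]

/-- If the orbit `A` of `⟨g⟩` and its translate `n • A` have bounded projections on each other, then
any point has, up to translation by `1` or `n⁻¹`, its projection on `A` near the base point. -/
theorem exists_smul_nearestPt_near {g : G} {x₀ : X} {C B : ℝ}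
    (hA : HasStrongProj C (cyclicOrbit g x₀)) {n : G}
    (h1 : ∀ x ∈ n • cyclicOrbit g x₀, ∀ p, IsNearestPt (cyclicOrbit g x₀) x p → dist x₀ p ≤ B)
    (h2 : ∀ x ∈ n⁻¹ • cyclicOrbit g x₀, ∀ p, IsNearestPt (cyclicOrbit g x₀) x p → dist x₀ p ≤ B)
    (x : X) : ∃ m : G, (m = 1 ∨ m = n⁻¹) ∧ ∃ p, IsNearestPt (cyclicOrbit g x₀) (m • x) p ∧
      dist x₀ p ≤ B + C := by
  have hA' := hA.smul n
  obtain ⟨p₁, hp₁⟩ := hA.exists_pt x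
  obtain ⟨p₂, hp₂⟩ := hA'.exists_pt x
  obtain ⟨q₁, hq₁⟩ := hA.exists_pt p₂
  obtain ⟨q₂, hq₂⟩ := hA'.exists_pt p₁
  obtain h | h := hA.behrstock hA' hp₁ hp₂ hq₁ hq₂
  · refine ⟨1, Or.inl rfl, p₁, by simpa using hp₁, ?_⟩
    have := h1 _ hp₂.1 _ hq₁
    have := dist_triangle_right x₀ p₁ q₁
    linarith
  · refine ⟨n⁻¹, Or.inr rfl, n⁻¹ • p₂, hp₂.inv_smul, ?_⟩
    have := h2 _ (Set.smul_mem_smul_set hp₁.1) _ hq₂.inv_smul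
    have := dist_triangle_right x₀ (n⁻¹ • p₂) (n⁻¹ • q₂)
    rw [dist_smul] at this
    linarith

/-- The elements `m₁⁻¹ g ^ k n g ^ (-k) m₂` with `m₁, m₂ ∈ {1, n⁻¹}` and `k` large do the job.
Indeed, when `m₁` and `m₂` are chosen such that `m₁ • z` and `m₂ • w` project near `x₀` on the orbit
`A` of `⟨g⟩`, a geodesic from `m₁ • z` to `g ^ k n g ^ (-k) m₂ • w` follows a long piece of `A`
starting near `x₀`, then a long piece of `g ^ k n • A`; in particular it passes near `x₀`. -/
theorem exists_finite_extension {g : G} {x₀ : X} {C B : ℝ}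
    (hA : HasStrongProj C (cyclicOrbit g x₀)) (N : Subgroup G) [N.Normal] {n : G} (hn : n ∈ N)
    (h1 : ∀ x ∈ n • cyclicOrbit g x₀, ∀ p, IsNearestPt (cyclicOrbit g x₀) x p → dist x₀ p ≤ B)
    (h2 : ∀ x ∈ n⁻¹ • cyclicOrbit g x₀, ∀ p, IsNearestPt (cyclicOrbit g x₀) x p → dist x₀ p ≤ B)
    (hlong : ∀ R : ℝ, ∃ k : ℤ, R < dist x₀ (g ^ k • x₀)) (o : X) :
    ∃ F : Finset G, (∀ f ∈ F, f ∈ N) ∧ ∃ r : ℝ, 0 ≤ r ∧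
      ∀ z w : X, ∃ f ∈ F, dist z o + dist o (f • w) ≤ dist z (f • w) + r := by
  classical
  set A := cyclicOrbit g x₀ with hAdef
  -- `k` is large enough for both long pieces: their end points are only known up to errors of at
  -- most `B + C`, and they have to be more than `C` apart
  obtain ⟨k, hk⟩ := hlong (2 * B + 3 * C)
  let T : Finset G := {1, n⁻¹}
  have hT : ∀ m ∈ T, m ∈ N := by
    intro m hm
    simp only [T, Finset.mem_insert, Finset.mem_singleton] at hm
    obtain rfl | rfl := hm
    · exact N.one_mem
    · exact N.inv_mem hn
  let e : G := g ^ k * n * (g ^ k)⁻¹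
  have he : e ∈ N := Subgroup.Normal.conj_mem ‹_› n hn _
  refine ⟨(T ×ˢ T).image fun m => m.1⁻¹ * e * m.2, ?_,
    |C + 2 * (B + C) + 2 * dist x₀ (n⁻¹ • x₀) + 2 * dist x₀ o|, abs_nonneg _, fun z w => ?_⟩
  · intro f hf
    simp only [Finset.mem_image, Finset.mem_product] at hf
    obtain ⟨m, ⟨hm1, hm2⟩, rfl⟩ := hf
    exact N.mul_mem (N.mul_mem (N.inv_mem (hT _ hm1)) he) (hT _ hm2)
  obtain ⟨m₁, hm₁, p, hp, hpB⟩ := exists_smul_nearestPt_near hA h1 h2 z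
  obtain ⟨m₂, hm₂, q, hq, hqB⟩ := exists_smul_nearestPt_near hA h1 h2 w
  refine ⟨m₁⁻¹ * e * m₂, ?_, ?_⟩
  · refine Finset.mem_image.2 ⟨(m₁, m₂), ?_, rfl⟩
    simp only [Finset.mem_product, T, Finset.mem_insert, Finset.mem_singleton]
    exact ⟨hm₁, hm₂⟩
  have hmx : dist x₀ (m₁ • x₀) ≤ dist x₀ (n⁻¹ • x₀) := by
    obtain rfl | rfl := hm₁
    · simp
    · exact le_rfl
  set w' := e • m₂ • w with hw'
  have hfw : (m₁⁻¹ * e * m₂) • w = m₁⁻¹ • w' := by simp [hw', mul_smul]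
  -- the projection of `w'` on `g ^ k n • A` is near `g ^ k n g ^ (-k) • x₀`
  have hA2 := hA.smul (g ^ k * n)
  have hq2 : IsNearestPt ((g ^ k * n) • A) w' (e • q) := by
    have := hq.smul e
    have hs : e • A = (g ^ k * n) • A := by
      simp only [e]
      rw [mul_smul (g ^ k * n), ← zpow_neg, hAdef, zpow_smul_cyclicOrbit]
    rwa [hs] at this
  obtain ⟨p₁, hp₁⟩ := hA.exists_pt w'
  obtain ⟨q₁, hq₁⟩ := hA.exists_pt (e • q)
  obtain ⟨q₂, hq₂⟩ := hA2.exists_pt p₁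
  have hq₁B : dist (g ^ k • x₀) q₁ ≤ B := by
    have hk' : IsNearestPt A ((g ^ k)⁻¹ • e • q) ((g ^ k)⁻¹ • q₁) := by
      apply IsNearestPt.inv_smul
      rwa [hAdef, zpow_smul_cyclicOrbit]
    have := h1 _ (by
      have := hq2.1
      rw [mul_smul] at this
      exact Set.mem_smul_set_iff_inv_smul_mem.1 this) _ hk'
    rwa [← dist_smul (g ^ k), smul_inv_smul] at this
  have hq₂B : dist ((g ^ k * n) • x₀) q₂ ≤ B := by
    have := h2 ((g ^ k * n)⁻¹ • p₁) (by
      rw [mul_inv_rev, mul_smul]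
      refine Set.smul_mem_smul_set ?_
      rw [← Set.mem_smul_set_iff_inv_smul_mem, hAdef, zpow_smul_cyclicOrbit]
      exact hp₁.1) _ hq₂.inv_smul
    rwa [← dist_smul (g ^ k * n), smul_inv_smul] at this
  have hB : 0 ≤ B := dist_nonneg.trans hq₁B
  have hC0 : 0 ≤ C := by simpa using hA.dist_add_dist_le_of_mem (isNearestPt_self hp.1) hp.1
  have hfar : C < dist (e • q) q₂ := by
    have e1 : dist (e • x₀) ((g ^ k * n) • x₀) = dist x₀ (g ^ k • x₀) := by
      simp only [e]
      rw [mul_smul (g ^ k * n), dist_smul, ← dist_smul (g ^ k), smul_inv_smul]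
    have e2 : dist (e • x₀) (e • q) ≤ B + C := by rwa [dist_smul]
    have := dist_triangle4 (e • x₀) (e • q) q₂ ((g ^ k * n) • x₀)
    rw [dist_comm q₂] at this
    linarith
  have hp₁q₁ : dist p₁ q₁ ≤ C :=
    (hA.behrstock hA2 hp₁ hq2 hq₁ hq₂).resolve_right (not_le.2 hfar)
  have hfar' : C < dist p p₁ := by
    have e1 := dist_triangle4 x₀ p p₁ (g ^ k • x₀)
    have e2 := dist_triangle_right p₁ (g ^ k • x₀) q₁
    linarith
  have key := hA.dist_le hp hp₁ hfar'
  rw [hfw]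
  have t1 : dist z (m₁⁻¹ • w') = dist (m₁ • z) w' := by
    rw [← dist_smul m₁, smul_inv_smul]
  have t2 : dist z o ≤ dist (m₁ • z) (m₁ • x₀) + dist x₀ o := by
    rw [dist_smul]; exact dist_triangle _ _ _
  have t3 : dist o (m₁⁻¹ • w') ≤ dist x₀ o + dist (m₁ • x₀) w' := by
    have : dist x₀ (m₁⁻¹ • w') = dist (m₁ • x₀) w' := by rw [← dist_smul m₁, smul_inv_smul]
    rw [← this, dist_comm x₀ o]
    exact dist_triangle _ _ _
  have t4 := dist_triangle4 (m₁ • z) p x₀ (m₁ • x₀)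
  have t5 := dist_triangle4 (m₁ • x₀) x₀ p w'
  have t6 := dist_triangle p p₁ w'
  rw [dist_comm p x₀] at t4
  rw [dist_comm (m₁ • x₀) x₀] at t5
  have t7 := le_abs_self (C + 2 * (B + C) + 2 * dist x₀ (n⁻¹ • x₀) + 2 * dist x₀ o)
  rw [t1]
  linarith

end Extension

/-! ### Elements whose translate of the axis has a large projection -/

section FellowTravel

open scoped Pointwise

variable {X : Type*} [MetricSpace X] {G : Type*} [Group G] [MulAction G X]

theorem finite_setOf_dist_smul_le [ProperSpace X] [ProperlyDiscontinuousSMul G X] (x : X)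
    (R : ℝ) : {h : G | dist x (h • x) ≤ R}.Finite := by
  refine (ProperlyDiscontinuousSMul.finite_disjoint_inter_image (Γ := G)
    (isCompact_singleton (x := x)) (isCompact_closedBall x R)).subset fun h hh => ?_
  exact ⟨h • x, ⟨x, rfl, rfl⟩, Metric.mem_closedBall'.2 hh⟩

/-- `u` conjugates a power of `g` with exponent at most `M` to another one, and it represents one
of the double cosets of `⟨g⟩` given by `S`. -/
def IsBoundedCommensurator (g : G) (S : Finset G) (M : ℕ) (u : G) : Prop :=
  (∃ i j : ℤ, ∃ s ∈ S, u = g ^ i * s * g ^ j) ∧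
    ∃ a b : ℤ, a ≠ 0 ∧ b ≠ 0 ∧ |a| ≤ M ∧ |b| ≤ M ∧ u * g ^ b = g ^ a * u

theorem IsBoundedCommensurator.inv {g : G} {S : Finset G} {M : ℕ} {u : G}
    (hS : ∀ s ∈ S, s⁻¹ ∈ S) (h : IsBoundedCommensurator g S M u) :
    IsBoundedCommensurator g S M u⁻¹ := by
  obtain ⟨⟨i, j, s, hs, hu⟩, a, b, ha, hb, haM, hbM, hab⟩ := h
  refine ⟨⟨-j, -i, s⁻¹, hS s hs, by rw [hu]; group⟩, b, a, hb, ha, hbM, haM, ?_⟩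
  rw [eq_mul_inv_iff_mul_eq, mul_assoc, ← hab, inv_mul_cancel_left]

variable [IsIsometricSMul G X]

/-- If the projection of `u • A` on the orbit `A` of `⟨g⟩` is large, then `A` and `u • A` follow
each other for a long time, and the pigeonhole principle on the finitely many elements with a given
bound on the displacement of `x₀` yields a relation between powers of `g` and `u g u⁻¹`. -/
theorem exists_isBoundedCommensurator_of_not_hasBoundedProj [ProperSpace X]
    [ProperlyDiscontinuousSMul G X] (hX : IsGeodesicMetricSpace X) {g : G} {x₀ : X} {C : ℝ}
    (hqi : IsQuasiIsometricEmbeddingInt fun n : ℤ => g ^ n • x₀)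
    (hA : HasStrongProj C (cyclicOrbit g x₀)) :
    ∃ (L : ℝ) (M : ℕ) (S : Finset G), (∀ s ∈ S, s⁻¹ ∈ S) ∧
      ∀ u : G, ¬ HasBoundedProj g x₀ L u → IsBoundedCommensurator g S M u := by
  obtain ⟨K, C₀, hK, hC₀, hqi⟩ := hqi
  have hC : 0 ≤ C := by
    have := hA.dist_add_dist_le_of_mem (isNearestPt_self (zpow_smul_mem_cyclicOrbit g x₀ 0))
      (zpow_smul_mem_cyclicOrbit g x₀ 0)
    simpa using this
  have hindex : ∀ a b : ℤ, ∀ d, dist (g ^ a • x₀) (g ^ b • x₀) ≤ d →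
      |(a : ℝ) - b| ≤ K * (d + C₀) := by
    intro a b d hd
    have h1 := (hqi a b).1
    have h2 : K⁻¹ * |(a : ℝ) - b| ≤ d + C₀ := by linarith
    rwa [inv_mul_le_iff₀ (by linarith)] at h2
  -- points of the geodesic between the projections are `C`-close to `A` and `2 * C`-close to `u • A`
  have hfin := finite_setOf_dist_smul_le (G := G) x₀ (3 * C)
  set S := hfin.toFinset with hS
  set n := S.card with hn
  -- the distance between two consecutive sample points of the geodesic between the projections
  set Δ := 4 * C + C₀ + 1 with hΔ
  have hΔ0 : 0 < Δ := by linarith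
  refine ⟨n * Δ + C, ⌈K * (n * Δ + 4 * C + C₀)⌉₊, S, fun s hs => ?_, fun u hu => ?_⟩
  · rw [hS, Set.Finite.mem_toFinset, Set.mem_ofPred_eq] at hs ⊢
    rwa [← dist_smul s, smul_inv_smul, dist_comm]
  simp only [HasBoundedProj, not_forall, not_le] at hu
  obtain ⟨x, hx, y, hy, p, q, hp, hq, hpq⟩ := hu
  have hnΔ : 0 ≤ n * Δ := by positivity
  have hxy := hA.dist_le hp hq (by linarith)
  have hA' := hA.smul u
  obtain ⟨γ, hγ, h0, h1⟩ := hX p q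
  set ℓ := dist p q with hℓ
  have hℓ0 : 0 ≤ ℓ := dist_nonneg
  have hclose : ∀ t ∈ Set.Icc 0 ℓ, ∃ i j : ℤ, dist (γ t) (g ^ i • x₀) ≤ C ∧
      dist (γ t) (u • g ^ j • x₀) ≤ 2 * C := by
    intro t ht
    have e1 : dist (γ t) p = t := by
      rw [dist_comm, ← h0, hγ.2 0 ⟨le_rfl, hℓ0⟩ t ht, sub_zero, abs_of_nonneg ht.1]
    have e2 : dist (γ t) q = ℓ - t := by
      rw [← h1, hγ.2 t ht ℓ ⟨hℓ0, le_rfl⟩, abs_of_nonneg (by linarith [ht.2])]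
    obtain ⟨s, hs⟩ := hA.exists_pt (γ t)
    obtain ⟨s', hs'⟩ := hA'.exists_pt (γ t)
    have f1 := hA.two_mul_dist_add_dist_le hp.1 hq.1 hs
    have f2 := hA'.two_mul_dist_add_dist_le hx hy hs'
    obtain ⟨i, rfl⟩ := hs.1
    obtain ⟨_, ⟨j, rfl⟩, rfl⟩ := hs'.1
    refine ⟨i, j, by dsimp only at f1; linarith, ?_⟩
    have f3 := dist_triangle (γ t) p x
    have f4 := dist_triangle (γ t) q y
    rw [dist_comm p x] at f3
    dsimp only at f2
    linarith
  have hmem : ∀ k : Fin (n + 1), (k : ℝ) * Δ ∈ Set.Icc 0 ℓ := by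
    intro k
    have hk : ((k : ℕ) : ℝ) ≤ n := by exact_mod_cast Nat.lt_succ_iff.1 k.2
    have := mul_le_mul_of_nonneg_right hk hΔ0.le
    exact ⟨by positivity, by linarith⟩
  choose i j hi hj using fun k : Fin (n + 1) => hclose _ (hmem k)
  have hSmem : ∀ k, (g ^ i k)⁻¹ * u * g ^ j k ∈ S := by
    intro k
    rw [hS, Set.Finite.mem_toFinset, Set.mem_ofPred_eq, mul_smul, mul_smul, ← dist_smul (g ^ i k),
      smul_inv_smul]
    have := dist_triangle_left (g ^ i k • x₀) (u • g ^ j k • x₀) (γ (k * Δ))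
    linarith [hi k, hj k]
  refine ⟨⟨i 0, -j 0, _, hSmem 0, by group⟩, ?_⟩
  obtain ⟨k, -, k', -, hkk', heq⟩ := Finset.exists_ne_map_eq_of_card_lt_of_maps_to
    (s := Finset.univ) (t := S) (by simp [← hn]) (fun k _ => hSmem k)
  have hd : dist (γ (k * Δ)) (γ (k' * Δ)) = |(k' : ℝ) - k| * Δ := by
    rw [hγ.2 _ (hmem k) _ (hmem k'), ← sub_mul, abs_mul, abs_of_pos hΔ0]
  have hd1 : Δ ≤ dist (γ (k * Δ)) (γ (k' * Δ)) := by
    rw [hd]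
    refine le_mul_of_one_le_left hΔ0.le ?_
    have : (1 : ℤ) ≤ |(k' : ℤ) - k| :=
      Int.one_le_abs (sub_ne_zero.2 fun h => hkk' (Fin.ext (by exact_mod_cast h.symm)))
    exact_mod_cast this
  have hd2 : dist (γ (k * Δ)) (γ (k' * Δ)) ≤ n * Δ := by
    rw [hd]
    refine mul_le_mul_of_nonneg_right ?_ hΔ0.le
    have h1 : ((k : ℕ) : ℝ) ≤ n := by exact_mod_cast Nat.lt_succ_iff.1 k.2
    have h2 : ((k' : ℕ) : ℝ) ≤ n := by exact_mod_cast Nat.lt_succ_iff.1 k'.2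
    have h3 : (0 : ℝ) ≤ (k : ℕ) := Nat.cast_nonneg _
    have h4 : (0 : ℝ) ≤ (k' : ℕ) := Nat.cast_nonneg _
    rw [abs_le]
    constructor <;> linarith
  have hM : ∀ a b : ℤ, dist (g ^ a • x₀) (g ^ b • x₀) ≤ n * Δ + 4 * C →
      |a - b| ≤ (⌈K * (n * Δ + 4 * C + C₀)⌉₊ : ℤ) := by
    intro a b hab
    have := (hindex a b _ hab).trans (Nat.le_ceil _)
    exact_mod_cast this
  have hii : dist (γ (k * Δ)) (γ (k' * Δ)) ≤
      C + dist (g ^ i k • x₀) (g ^ i k' • x₀) + C := by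
    refine (dist_triangle4 _ (g ^ i k • x₀) (g ^ i k' • x₀) _).trans ?_
    rw [dist_comm _ (γ (k' * Δ))]
    linarith [hi k, hi k']
  have hjj : dist (γ (k * Δ)) (γ (k' * Δ)) ≤
      2 * C + dist (g ^ j k • x₀) (g ^ j k' • x₀) + 2 * C := by
    refine (dist_triangle4 _ (u • g ^ j k • x₀) (u • g ^ j k' • x₀) _).trans ?_
    rw [dist_comm _ (γ (k' * Δ)), dist_smul]
    linarith [hj k, hj k']
  refine ⟨i k - i k', j k - j k', ?_, ?_, hM _ _ ?_, hM _ _ ?_, ?_⟩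
  · intro h
    rw [sub_eq_zero.1 h, dist_self] at hii
    linarith
  · intro h
    rw [sub_eq_zero.1 h, dist_self] at hjj
    linarith
  · refine (dist_triangle4 _ (γ (k * Δ)) (γ (k' * Δ)) _).trans ?_
    rw [dist_comm _ (γ (k * Δ))]
    linarith [hi k, hi k']
  · rw [← dist_smul u]
    refine (dist_triangle4 _ (γ (k * Δ)) (γ (k' * Δ)) _).trans ?_
    rw [dist_comm _ (γ (k * Δ))]
    linarith [hj k, hj k']
  · rw [zpow_sub, zpow_sub, ← mul_assoc, mul_inv_eq_iff_eq_mul]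
    have : u * g ^ j k = g ^ i k * ((g ^ i k)⁻¹ * u * g ^ j k) := by group
    rw [this, heq]
    group

/-- Conversely, if `u` conjugates a nontrivial power of `g` to a power of `g`, then `u • A` has an
unbounded projection on the orbit `A` of `⟨g⟩`. -/
theorem not_hasBoundedProj_of_commensurates {g : G} {x₀ : X} {C : ℝ}
    (hqi : IsQuasiIsometricEmbeddingInt fun n : ℤ => g ^ n • x₀)
    (hA : HasStrongProj C (cyclicOrbit g x₀)) {u : G} {a b : ℤ} (ha : a ≠ 0)
    (hab : u * g ^ b = g ^ a * u) (L : ℝ) : ¬ HasBoundedProj g x₀ L u := by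
  intro hbd
  obtain ⟨K, C₀, hK, hC₀, hqi⟩ := hqi
  set R := dist x₀ (u • x₀) with hR
  have hpow : ∀ t : ℤ, u * g ^ (b * t) = g ^ (a * t) * u := by
    intro t
    have h : u * g ^ b * u⁻¹ = g ^ a := by rw [hab, mul_inv_cancel_right]
    rw [zpow_mul, zpow_mul, ← h, conj_zpow, inv_mul_cancel_right]
  have hnear : ∀ t : ℤ, ∀ p, IsNearestPt (cyclicOrbit g x₀) (u • g ^ (b * t) • x₀) p →
      dist (g ^ (a * t) • x₀) p ≤ 2 * R := by
    intro t p hp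
    have h1 : dist (u • g ^ (b * t) • x₀) (g ^ (a * t) • x₀) = R := by
      rw [← mul_smul, hpow, mul_smul, dist_smul, dist_comm]
    have h2 := hp.2 _ (zpow_smul_mem_cyclicOrbit g x₀ (a * t))
    have h3 := dist_triangle_left (g ^ (a * t) • x₀) p (u • g ^ (b * t) • x₀)
    linarith
  obtain ⟨t, ht⟩ := exists_nat_gt (K * (L + 4 * R + C₀))
  obtain ⟨p, hp⟩ := hA.exists_pt (u • g ^ (b * 0) • x₀)
  obtain ⟨q, hq⟩ := hA.exists_pt (u • g ^ (b * (t : ℤ)) • x₀)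
  have h1 := hnear _ _ hp
  have h2 := hnear _ _ hq
  have h3 := hbd _ (Set.smul_mem_smul_set (zpow_smul_mem_cyclicOrbit g x₀ _)) _
    (Set.smul_mem_smul_set (zpow_smul_mem_cyclicOrbit g x₀ _)) _ _ hp hq
  have h4 := (hqi (a * 0) (a * t)).1
  have h5 := dist_triangle4 (g ^ (a * 0) • x₀) p q (g ^ (a * (t : ℤ)) • x₀)
  rw [dist_comm q] at h5
  have h6 : (t : ℝ) ≤ |((a * 0 : ℤ) : ℝ) - ((a * t : ℤ) : ℝ)| := by
    have : (1 : ℝ) ≤ |(a : ℝ)| := by exact_mod_cast Int.one_le_abs ha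
    simp only [mul_zero, Int.cast_zero, zero_sub, abs_neg, Int.cast_mul, abs_mul,
      Int.cast_natCast, Nat.abs_cast]
    exact le_mul_of_one_le_left (Nat.cast_nonneg _) this
  have h7 : K⁻¹ * |((a * 0 : ℤ) : ℝ) - ((a * t : ℤ) : ℝ)| ≤ L + 4 * R + C₀ := by
    dsimp only at h4
    linarith
  rw [inv_mul_le_iff₀ (by linarith)] at h7
  linarith

end FellowTravel

/-! ### Powers conjugate to each other -/

section TranslationLength

open Filter Topology

variable {X : Type*} [MetricSpace X] {G : Type*} [Group G] [MulAction G X] [IsIsometricSMul G X]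

theorem dist_zpow_smul_eq_natAbs (g : G) (x : X) (a : ℤ) :
    dist x (g ^ a • x) = dist x (g ^ a.natAbs • x) := by
  obtain h | h := Int.natAbs_eq a
  · conv_lhs => rw [h, zpow_natCast]
  · conv_lhs => rw [h, zpow_neg, zpow_natCast, ← dist_smul (g ^ a.natAbs), smul_inv_smul, dist_comm]

theorem subadditive_dist_pow_smul (g : G) (x : X) :
    Subadditive fun n : ℕ => dist x (g ^ n • x) := by
  intro m n
  refine (dist_triangle x (g ^ m • x) _).trans ?_
  rw [pow_add, mul_smul, dist_smul]

/-- Conjugate elements have the same translation length, which is multiplicative on powers and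
positive for `g` since its orbits are quasi-isometrically embedded. -/
theorem natAbs_le_natAbs_of_commensurates {g : G} {x₀ : X}
    (hqi : IsQuasiIsometricEmbeddingInt fun n : ℤ => g ^ n • x₀) {u : G} {a b : ℤ}
    (hab : u * g ^ b = g ^ a * u) : a.natAbs ≤ b.natAbs := by
  obtain ⟨K, C₀, hK, hC₀, hqi⟩ := hqi
  set f : ℕ → ℝ := fun n => dist x₀ (g ^ n • x₀) with hf
  have hsub : Subadditive f := subadditive_dist_pow_smul g x₀
  -- `hsub.lim` is the translation length of `g`
  have hlim := hsub.tendsto_lim ⟨0, by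
    rintro _ ⟨n, rfl⟩
    exact div_nonneg dist_nonneg (Nat.cast_nonneg _)⟩
  have hscale : ∀ m : ℕ, Tendsto (fun t : ℕ => f (m * t) / t) atTop (𝓝 (m * hsub.lim)) := by
    intro m
    obtain rfl | hm := Nat.eq_zero_or_pos m
    · simp [hf]
    have h1 : Tendsto (fun t : ℕ => m * t) atTop atTop :=
      tendsto_id.const_mul_atTop' hm
    refine ((hlim.comp h1).const_mul (m : ℝ)).congr fun t => ?_
    have : (m : ℝ) ≠ 0 := by positivity
    simp only [Function.comp_apply, Nat.cast_mul]
    rw [← mul_div_assoc, mul_div_mul_left _ _ this]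
  have hpos : 0 < hsub.lim := by
    have h1 : K⁻¹ ≤ hsub.lim := by
      have h2 : Tendsto (fun n : ℕ => K⁻¹ - C₀ / n) atTop (𝓝 (K⁻¹ - 0)) :=
        tendsto_const_nhds.sub (tendsto_const_div_atTop_nhds_zero_nat C₀)
      rw [sub_zero] at h2
      refine le_of_tendsto_of_tendsto h2 hlim ?_
      filter_upwards [eventually_gt_atTop 0] with n hn
      have hn' : (0 : ℝ) < n := by exact_mod_cast hn
      rw [le_div_iff₀ hn', sub_mul, div_mul_cancel₀ _ hn'.ne']
      simpa using (hqi 0 n).1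
    have : 0 < K⁻¹ := by positivity
    linarith
  have hle : ∀ t : ℕ, f (a.natAbs * t) ≤ f (b.natAbs * t) + 2 * dist x₀ (u • x₀) := by
    intro t
    have hz : ∀ c : ℤ, f (c.natAbs * t) = dist x₀ (g ^ (c * t) • x₀) := by
      intro c
      rw [dist_zpow_smul_eq_natAbs, Int.natAbs_mul, Int.natAbs_natCast]
    have hpow : g ^ (a * (t : ℤ)) * u = u * g ^ (b * (t : ℤ)) := by
      have h : u * g ^ b * u⁻¹ = g ^ a := by rw [hab, mul_inv_cancel_right]
      rw [zpow_mul, zpow_mul, ← h, conj_zpow, inv_mul_cancel_right]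
    rw [hz, hz]
    have h1 := dist_triangle4 x₀ (u • x₀) ((g ^ (a * (t : ℤ)) * u) • x₀) (g ^ (a * (t : ℤ)) • x₀)
    have h2 : dist ((g ^ (a * (t : ℤ)) * u) • x₀) (g ^ (a * (t : ℤ)) • x₀) =
        dist x₀ (u • x₀) := by rw [mul_smul, dist_smul, dist_comm]
    have h3 : dist (u • x₀) ((g ^ (a * (t : ℤ)) * u) • x₀) =
        dist x₀ (g ^ (b * (t : ℤ)) • x₀) := by rw [hpow, mul_smul, dist_smul]
    linarith
  have hfinal : (a.natAbs : ℝ) * hsub.lim ≤ b.natAbs * hsub.lim := by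
    have h1 := (hscale b.natAbs).add
      (tendsto_const_div_atTop_nhds_zero_nat (2 * dist x₀ (u • x₀)))
    rw [add_zero] at h1
    refine le_of_tendsto_of_tendsto' (hscale a.natAbs) h1 fun t => ?_
    rw [← add_div]
    exact div_le_div_of_nonneg_right (hle t) (Nat.cast_nonneg _)
  exact_mod_cast le_of_mul_le_mul_right hfinal hpos

theorem natAbs_eq_natAbs_of_commensurates {g : G} {x₀ : X}
    (hqi : IsQuasiIsometricEmbeddingInt fun n : ℤ => g ^ n • x₀) {u : G} {a b : ℤ}
    (hab : u * g ^ b = g ^ a * u) : a.natAbs = b.natAbs := by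
  refine le_antisymm (natAbs_le_natAbs_of_commensurates hqi hab)
    (natAbs_le_natAbs_of_commensurates hqi (u := u⁻¹) ?_)
  rw [eq_mul_inv_iff_mul_eq, mul_assoc, ← hab, inv_mul_cancel_left]

end TranslationLength

/-! ### An element of `N` moving the axis away from itself -/

section NormalSubgroup

open scoped Nat

variable {X : Type*} [MetricSpace X] {G : Type*} [Group G] [MulAction G X] [IsIsometricSMul G X]

/-- A bounded commensurator normalizes the subgroup generated by `g ^ M !`, hence bounded
commensurators lie in finitely many cosets of this subgroup. -/
theorem exists_finset_coset_cover {g : G} {x₀ : X}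
    (hqi : IsQuasiIsometricEmbeddingInt fun n : ℤ => g ^ n • x₀) (S : Finset G) (M : ℕ) :
    ∃ T : Finset G, ∀ u, IsBoundedCommensurator g S M u →
      ∃ t ∈ T, t⁻¹ * u ∈ Subgroup.zpowers (g ^ M !) := by
  classical
  have hpos : (0 : ℤ) < (M ! : ℕ) := by exact_mod_cast M.factorial_pos
  let I : Finset ℤ := Finset.Ico 0 (M ! : ℕ)
  refine ⟨(I ×ˢ S ×ˢ I).image fun x => g ^ x.1 * x.2.1 * g ^ x.2.2, ?_⟩
  rintro u ⟨⟨i, j, s, hs, hu⟩, a, b, ha, hb, haM, hbM, hab⟩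
  have hnorm : ∀ k : ℤ, ∃ k' : ℤ, g ^ ((M ! : ℕ) * k) * u = u * g ^ ((M ! : ℕ) * k') := by
    intro k
    have hbdvd : a ∣ (M ! : ℕ) := by
      rw [← Int.natAbs_dvd, Int.natCast_dvd_natCast]
      refine Nat.dvd_factorial (Int.natAbs_pos.2 ha) ?_
      rw [Int.abs_eq_natAbs] at haM
      exact_mod_cast haM
    obtain ⟨c, hc⟩ := hbdvd
    have hpow : ∀ t : ℤ, g ^ (a * t) * u = u * g ^ (b * t) := by
      intro t
      have h : u * g ^ b * u⁻¹ = g ^ a := by rw [hab, mul_inv_cancel_right]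
      rw [zpow_mul, zpow_mul, ← h, conj_zpow, inv_mul_cancel_right]
    obtain h | h := Int.natAbs_eq_natAbs_iff.1 (natAbs_eq_natAbs_of_commensurates hqi hab)
    · refine ⟨k, ?_⟩
      rw [hc, mul_assoc, hpow, h]
    · refine ⟨-k, ?_⟩
      rw [hc, mul_assoc, hpow, h]
      congr 2
      ring
  obtain ⟨k', hk'⟩ := hnorm (-(i / (M ! : ℕ)))
  refine ⟨g ^ (i % (M ! : ℕ)) * s * g ^ (j % (M ! : ℕ)), ?_, ?_⟩
  · refine Finset.mem_image.2 ⟨(i % (M ! : ℕ), s, j % (M ! : ℕ)), ?_, rfl⟩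
    simp only [Finset.mem_product, I, Finset.mem_Ico]
    exact ⟨⟨Int.emod_nonneg _ hpos.ne', Int.emod_lt_of_pos _ hpos⟩, hs,
      Int.emod_nonneg _ hpos.ne', Int.emod_lt_of_pos _ hpos⟩
  · refine Subgroup.mem_zpowers_iff.2 ⟨j / (M ! : ℕ) + -k', ?_⟩
    rw [← zpow_natCast g, ← zpow_mul, eq_inv_mul_iff_mul_eq, mul_add, zpow_add, ← mul_assoc,
      mul_neg, zpow_neg, mul_inv_eq_iff_eq_mul, ← hk']
    have hi : -((i / (M ! : ℕ)) * (M ! : ℕ)) + i = i % (M ! : ℕ) := by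
      have := Int.emod_add_mul_ediv i (M ! : ℕ)
      linarith
    have hj : j % (M ! : ℕ) + (M ! : ℕ) * (j / (M ! : ℕ)) = j := Int.emod_add_mul_ediv j _
    rw [mul_assoc _ (g ^ (j % _)), ← zpow_add, hj, ← hi, zpow_add, hu]
    simp only [mul_assoc, mul_neg, mul_comm]

theorem isVirtuallyCyclicGroup_of_cover {h : G} {T : Finset G}
    (hT : ∀ u : G, ∃ t ∈ T, t⁻¹ * u ∈ Subgroup.zpowers h) : IsVirtuallyCyclicGroup G := by
  refine ⟨Subgroup.zpowers h, inferInstance, ?_⟩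
  have : Finite (G ⧸ Subgroup.zpowers h) := by
    refine Finite.of_surjective (fun t : T => (QuotientGroup.mk t.1 : G ⧸ Subgroup.zpowers h)) ?_
    intro x
    obtain ⟨u, rfl⟩ := QuotientGroup.mk_surjective x
    obtain ⟨t, ht, htu⟩ := hT u
    exact ⟨⟨t, ht⟩, QuotientGroup.eq.2 htu⟩
  exact Subgroup.finiteIndex_of_finite_quotient

/-- If an infinite set is covered by finitely many left cosets of `H`, two of its elements differ
by an element of `H`. -/
theorem exists_ne_inv_mul_mem_of_cover {ι : Type*} [Infinite ι] {H : Subgroup G} {T : Finset G}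
    (v : ι → G) (hT : ∀ i, ∃ t ∈ T, t⁻¹ * v i ∈ H) : ∃ i j, i ≠ j ∧ (v i)⁻¹ * v j ∈ H := by
  choose t ht hv using hT
  obtain ⟨i, j, hij, h⟩ := Finite.exists_ne_map_eq_of_infinite fun i => (⟨t i, ht i⟩ : T)
  refine ⟨i, j, hij, ?_⟩
  have h' : t i = t j := congrArg Subtype.val h
  have := H.mul_mem (H.inv_mem (hv i)) (hv j)
  rw [h'] at this
  simpa [mul_assoc] using this

/-- An infinite normal subgroup `N` contains an element `n` such that the orbit `A` of `⟨g⟩` and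
`n • A` have bounded projections on each other. Otherwise `N` is covered by finitely many cosets of
a cyclic group `⟨g ^ M !⟩`, so that `N` contains a power of `g`, and then every element of `G`
commensurates `⟨g⟩`; thus `G` would be virtually cyclic. -/
theorem exists_mem_hasBoundedProj [ProperSpace X] [ProperlyDiscontinuousSMul G X]
    (hX : IsGeodesicMetricSpace X) (hG : ¬ IsVirtuallyCyclicGroup G) {g : G} {x₀ : X} {C : ℝ}
    (hqi : IsQuasiIsometricEmbeddingInt fun n : ℤ => g ^ n • x₀)
    (hA : HasStrongProj C (cyclicOrbit g x₀)) (N : Subgroup G) [hN : N.Normal] [Infinite N] :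
    ∃ L, ∃ n ∈ N, HasBoundedProj g x₀ L n ∧ HasBoundedProj g x₀ L n⁻¹ := by
  obtain ⟨L, M, S, hS, hL⟩ := exists_isBoundedCommensurator_of_not_hasBoundedProj hX hqi hA
  obtain ⟨T, hT⟩ := exists_finset_coset_cover hqi S M
  refine ⟨L, ?_⟩
  by_contra! hcon
  have hNE : ∀ n ∈ N, ∃ t ∈ T, t⁻¹ * n ∈ Subgroup.zpowers (g ^ M !) := by
    intro n hn
    refine hT n ?_
    by_cases h : HasBoundedProj g x₀ L n
    · simpa using (hL _ (hcon n hn h)).inv hS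
    · exact hL n h
  -- a nontrivial power of `g` belongs to `N`
  obtain ⟨k, hk0, hkN⟩ : ∃ k : ℤ, k ≠ 0 ∧ g ^ k ∈ N := by
    obtain ⟨n₁, n₂, hne, h⟩ := exists_ne_inv_mul_mem_of_cover (fun n : N => (n : G))
      fun n => hNE n n.2
    obtain ⟨k, hk⟩ := Subgroup.mem_zpowers_iff.1 h
    rw [← zpow_natCast, ← zpow_mul] at hk
    refine ⟨_, fun h0 => hne ?_, hk ▸ N.mul_mem (N.inv_mem n₁.2) n₂.2⟩
    rw [h0, zpow_zero, eq_comm, inv_mul_eq_one] at hk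
    exact Subtype.ext hk
  -- some power of `u g ^ k u⁻¹ ∈ N` belongs to `⟨g ^ M !⟩`, so that `u` commensurates `⟨g⟩`
  refine hG (isVirtuallyCyclicGroup_of_cover (h := g ^ M !) (T := T) fun u => hT u (hL u ?_))
  obtain ⟨s, t, hst, h⟩ := exists_ne_inv_mul_mem_of_cover (fun s : ℤ => (u * g ^ k * u⁻¹) ^ s)
    fun s => hNE _ (N.zpow_mem (hN.conj_mem _ hkN u) s)
  obtain ⟨c, hc⟩ := Subgroup.mem_zpowers_iff.1 h
  rw [← zpow_natCast, ← zpow_mul, ← zpow_neg, ← zpow_add, conj_zpow, ← zpow_mul,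
    eq_mul_inv_iff_mul_eq] at hc
  refine not_hasBoundedProj_of_commensurates hqi hA ?_ hc.symm L
  intro h0
  have := natAbs_eq_natAbs_of_commensurates hqi hc.symm
  rw [h0] at this
  simp only [Int.natAbs_zero, eq_comm, Int.natAbs_eq_zero, mul_eq_zero, hk0, false_or] at this
  exact hst (by linarith)

end NormalSubgroup

/-! ### Shadows in the horocompactification -/

section Shadow

variable {X : Type*} [MetricSpace X]

namespace Horocompactification

theorem continuous_eval (x y : X) :
    Continuous fun c : Horocompactification X => c.eval x y :=
  (ContinuousEvalConst.continuous_eval_const (F := C(X × X, ℝ)) (x, y)).comp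
    (continuous_subtype_val.comp continuous_subtype_val)

/-- The point of the horocompactification given by a point of `X`. -/
def ofPoint (z : X) : Horocompactification X := ⟨pointCocycle z, subset_closure ⟨z, rfl⟩⟩

theorem denseRange_ofPoint : DenseRange (ofPoint : X → Horocompactification X) := by
  refine (Subtype.dense_iff (s := closure (Set.range (pointCocycle (X := X))))).2 ?_
  refine closure_mono ?_
  rintro _ ⟨z, rfl⟩
  exact ⟨ofPoint z, ⟨z, rfl⟩, rfl⟩

theorem eval_le_dist (c : Horocompactification X) (x y : X) : c.eval x y ≤ dist x y := by
  refine denseRange_ofPoint.induction_on c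
    (isClosed_Iic.preimage (continuous_eval x y) : IsClosed {c | eval c x y ≤ dist x y})
    fun z => ?_
  change dist x z - dist y z ≤ dist x y
  linarith [dist_triangle x y z]

theorem eval_swap (c : Horocompactification X) (x y : X) : c.eval x y = -c.eval y x := by
  have h1 := c.1.2 x y x
  have h2 := c.1.2 x x x
  change c.1.1 (x, y) = -c.1.1 (y, x)
  linarith

theorem neg_dist_le_eval (c : Horocompactification X) (x y : X) : -dist x y ≤ c.eval x y := by
  rw [eval_swap, dist_comm]
  exact neg_le_neg (eval_le_dist c y x)

end Horocompactification

open Horocompactification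

theorem continuous_horoGromovProduct (x y : X) :
    Continuous fun c : Horocompactification X => horoGromovProduct x c y :=
  continuous_const.mul (continuous_const.add (continuous_eval y x))

theorem isClosed_horoShadow (x y : X) (r : ℝ) : IsClosed (horoShadow x y r) :=
  isClosed_Iic.preimage (continuous_horoGromovProduct x y)

theorem measurableSet_horoShadow (x y : X) (r : ℝ) : MeasurableSet (horoShadow x y r) :=
  (isClosed_horoShadow x y r).measurableSet

/-- If finitely many elements always send a point of `X` into a shadow, they always send a point of
the horocompactification into it, by density. -/
theorem exists_smul_mem_horoShadow {G : Type*} [Group G] [MulAction G X] [IsIsometricSMul G X]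
    {F : Finset G} {o z : X} {r : ℝ}
    (hF : ∀ w : X, ∃ f ∈ F, dist z o + dist o (f • w) ≤ dist z (f • w) + 2 * r)
    (c : Horocompactification X) : ∃ f ∈ F, f • c ∈ horoShadow z o r := by
  have hclosed : IsClosed (⋃ f ∈ F, {c : Horocompactification X | f • c ∈ horoShadow z o r}) := by
    refine isClosed_biUnion_finset fun f _ => (isClosed_horoShadow z o r).preimage ?_
    apply Continuous.subtype_mk
    exact (ContCocycle.continuous_translate f).comp continuous_subtype_val
  have := denseRange_ofPoint.induction_on
    (p := fun c => c ∈ ⋃ f ∈ F, {c : Horocompactification X | f • c ∈ horoShadow z o r})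
    c hclosed fun w => ?_
  · simpa using this
  obtain ⟨f, hf, h⟩ := hF w
  refine Set.mem_iUnion₂.2 ⟨f, hf, ?_⟩
  have hd : ∀ x : X, dist (f⁻¹ • x) w = dist x (f • w) := fun x => by
    rw [← dist_smul f, smul_inv_smul]
  change 1 / 2 * (dist z o + (dist (f⁻¹ • o) w - dist (f⁻¹ • z) w)) ≤ r
  rw [hd, hd]
  linarith

end Shadow

/-! ### Measures of shadows -/

section Measures

variable {X : Type*} [MetricSpace X] {o : X} {ω : ℝ} {ν : X → Measure (Horocompactification X)}

namespace IsConformalDensity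

theorem measure_le (hν : IsConformalDensity o ω ν) (x y : X) {s : Set (Horocompactification X)}
    (hs : MeasurableSet s) {a : ℝ} (h : ∀ c ∈ s, -ω * c.eval x y ≤ a) :
    ν x s ≤ ENNReal.ofReal (Real.exp a) * ν y s := by
  have := hν.finite x
  have := hν.finite y
  calc ν x s = (ν y).withDensity ((ν x).rnDeriv (ν y)) s := by
        rw [Measure.withDensity_rnDeriv_eq _ _ (hν.absolutelyContinuous x y)]
    _ = ∫⁻ c in s, ENNReal.ofReal (Real.exp (-ω * c.eval x y)) ∂(ν y) := by
        rw [withDensity_apply _ hs]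
        exact lintegral_congr_ae (ae_restrict_of_ae (hν.conformal x y))
    _ ≤ ∫⁻ _ in s, ENNReal.ofReal (Real.exp a) ∂(ν y) :=
        setLIntegral_mono' hs fun c hc =>
          ENNReal.ofReal_le_ofReal (Real.exp_le_exp.2 (h c hc))
    _ = ENNReal.ofReal (Real.exp a) * ν y s := setLIntegral_const _ _

theorem measureReal_le (hν : IsConformalDensity o ω ν) (x y : X)
    {s : Set (Horocompactification X)} (hs : MeasurableSet s) {a : ℝ}
    (h : ∀ c ∈ s, -ω * c.eval x y ≤ a) : (ν x).real s ≤ Real.exp a * (ν y).real s := by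
  have := hν.finite y
  have := ENNReal.toReal_mono (ENNReal.mul_ne_top ENNReal.ofReal_ne_top (measure_ne_top _ _))
    (hν.measure_le x y hs h)
  rwa [ENNReal.toReal_mul, ENNReal.toReal_ofReal (Real.exp_pos _).le] at this

theorem measureReal_le_exp_dist (hν : IsConformalDensity o ω ν) (hω : 0 ≤ ω) (x y : X)
    {s : Set (Horocompactification X)} (hs : MeasurableSet s) :
    (ν x).real s ≤ Real.exp (ω * dist x y) * (ν y).real s := by
  refine hν.measureReal_le x y hs fun c _ => ?_
  have := mul_le_mul_of_nonneg_left (c.neg_dist_le_eval x y) hω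
  linarith

/-- On the `r`-shadow of `y` seen from `x` the cocycle `c(x, y)` is at least `d(x, y) - 2 r`. -/
theorem measureReal_horoShadow_le (hν : IsConformalDensity o ω ν) (hω : 0 ≤ ω) (x y : X) (r : ℝ) :
    (ν x).real (horoShadow x y r) ≤
      Real.exp (2 * ω * r) * (ν y).real Set.univ * Real.exp (-ω * dist x y) := by
  have := hν.finite y
  have h := hν.measureReal_le x y (measurableSet_horoShadow x y r)
    (a := 2 * ω * r + -ω * dist x y) fun c hc => by
      have h1 : 1 / 2 * (dist x y + c.eval y x) ≤ r := hc
      rw [c.eval_swap x y]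
      have := mul_le_mul_of_nonneg_left h1 hω
      linarith
  rw [Real.exp_add] at h
  refine h.trans ?_
  have : (ν y).real (horoShadow x y r) ≤ (ν y).real Set.univ := measureReal_mono (Set.subset_univ _)
  calc _ ≤ Real.exp (2 * ω * r) * Real.exp (-ω * dist x y) * (ν y).real Set.univ := by gcongr
    _ = _ := by ring

variable {G : Type*} [Group G] [MulAction G X] [IsIsometricSMul G X]

/-- If finitely many translates of a set by elements preserving the density cover the
horocompactification, then this set has a definite proportion of the mass of `ν x`. -/
theorem measureReal_univ_le_of_cover (hν : IsConformalDensity o ω ν) (hω : 0 ≤ ω) {N : Subgroup G}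
    (hN : IsInvariantDensity N ν) (x : X) {ι : Type*} (F : Finset ι) (φ : ι → G)
    (hφ : ∀ i ∈ F, φ i ∈ N) {s : Set (Horocompactification X)} (hs : MeasurableSet s)
    (hcover : ∀ c : Horocompactification X, ∃ i ∈ F, φ i • c ∈ s) :
    (ν x).real Set.univ ≤ (∑ i ∈ F, Real.exp (ω * dist (φ i • x) x)) * (ν x).real s := by
  have := hν.finite x
  have huniv : (Set.univ : Set (Horocompactification X)) ⊆
      ⋃ i ∈ F, (fun c => φ i • c) ⁻¹' s := fun c _ => by
    obtain ⟨i, hi, hc⟩ := hcover c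
    exact Set.mem_iUnion₂.2 ⟨i, hi, hc⟩
  calc (ν x).real Set.univ ≤ (ν x).real (⋃ i ∈ F, (fun c => φ i • c) ⁻¹' s) :=
        measureReal_mono huniv (measure_ne_top _ _)
    _ ≤ ∑ i ∈ F, (ν x).real ((fun c => φ i • c) ⁻¹' s) := measureReal_biUnion_finset_le _ _
    _ ≤ ∑ i ∈ F, Real.exp (ω * dist (φ i • x) x) * (ν x).real s := by
        refine Finset.sum_le_sum fun i hi => ?_
        have : (ν x).real ((fun c => φ i • c) ⁻¹' s) = (ν (φ i • x)).real s := by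
          rw [← hN _ (hφ i hi) x, Measure.real, Measure.real,
            Measure.map_apply (Horocompactification.measurable_smul _) hs]
        rw [this]
        exact hν.measureReal_le_exp_dist hω _ _ hs
    _ = _ := by rw [Finset.sum_mul]

end IsConformalDensity

end Measures

/-! ### The Shadow Lemma -/

theorem mainTheorem6 {X : Type*} [MetricSpace X] [ProperSpace X] (hX : IsGeodesicMetricSpace X)
    {G : Type*} [Group G] [MulAction G X] [IsIsometricSMul G X] [ProperlyDiscontinuousSMul G X]
    (hG : ¬ IsVirtuallyCyclicGroup G) (hcontr : ∃ g : G, IsContractingElement X g)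
    (N : Subgroup G) [N.Normal] [Infinite N] (o : X) (ω : ℝ) (hω : 0 ≤ ω) :
    ∃ ε r₀ : ℝ, 0 < ε ∧ 0 ≤ r₀ ∧
      ∀ ν : X → Measure (Horocompactification X),
        IsConformalDensity o ω ν → IsInvariantDensity N ν →
          (∀ r : ℝ, r₀ ≤ r → ∀ g : G,
            ε * (ν (g • o)).real Set.univ * Real.exp (-ω * dist o (g • o))
                ≤ (ν o).real (horoShadow o (g • o) r) ∧
              (ν o).real (horoShadow o (g • o) r)
                ≤ Real.exp (2 * ω * r) * (ν (g • o)).real Set.univ *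
                  Real.exp (-ω * dist o (g • o))) ∧
          SatisfiesShadowPrinciple G o ω ν ε r₀ := by
  obtain ⟨a, x₀, hqi, α, hα, hY⟩ := hcontr
  have hA : HasStrongProj (8 * α) (cyclicOrbit a x₀) :=
    IsContractingWith.hasStrongProj hX hα (Set.range_nonempty _) hY
  obtain ⟨L, n, hn, hL1, hL2⟩ := exists_mem_hasBoundedProj hX hG hqi hA N
  obtain ⟨B₁, hB₁⟩ := hL1.exists_dist_le hA
  obtain ⟨B₂, hB₂⟩ := hL2.exists_dist_le hA
  have hlong : ∀ R : ℝ, ∃ k : ℤ, R < dist x₀ (a ^ k • x₀) := by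
    intro R
    obtain ⟨K, C₀, hK, -, hqi⟩ := hqi
    obtain ⟨k, hk⟩ := exists_nat_gt (K * (R + C₀))
    refine ⟨k, ?_⟩
    have h := (hqi 0 k).1
    simp only [zpow_zero, one_smul, Int.cast_zero, Int.cast_natCast, zero_sub, abs_neg,
      Nat.abs_cast] at h
    have : R + C₀ < K⁻¹ * k := by rwa [lt_inv_mul_iff₀ (by linarith)]
    linarith
  obtain ⟨F, hFN, r₀, hr₀, hF⟩ := exists_finite_extension hA N hn (B := max B₁ B₂)
    (fun x hx p hp => (hB₁ x hx p hp).trans (le_max_left _ _))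
    (fun x hx p hp => (hB₂ x hx p hp).trans (le_max_right _ _)) hlong o
  set Λ := ∑ f ∈ F, Real.exp (ω * dist (f • o) o) with hΛ
  have hΛ0 : 0 ≤ Λ := Finset.sum_nonneg fun f _ => (Real.exp_pos _).le
  refine ⟨(1 + Λ)⁻¹, r₀ / 2, by positivity, by positivity, fun ν hν hN => ?_⟩
  have hlower : ∀ (g : G) (r : ℝ), r₀ / 2 ≤ r →
      (1 + Λ)⁻¹ * (ν (g • o)).real Set.univ * Real.exp (-ω * dist o (g • o)) ≤
        (ν o).real (horoShadow o (g • o) r) := by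
    intro g r hr
    have := hν.finite o
    set s := horoShadow o (g • o) r
    have hs : MeasurableSet s := measurableSet_horoShadow _ _ _
    -- the conjugates of `F` by `g` play at `g • o` the role of `F` at `o`
    have hcover : ∀ c : Horocompactification X, ∃ f ∈ F, (g * f * g⁻¹) • c ∈ s := by
      classical
      intro c
      obtain ⟨f', hf', hc⟩ := exists_smul_mem_horoShadow (F := F.image fun f => g * f * g⁻¹)
        (o := g • o) (z := o) (r := r) (fun w => by
          obtain ⟨f, hf, h⟩ := hF (g⁻¹ • o) (g⁻¹ • w)
          refine ⟨g * f * g⁻¹, Finset.mem_image_of_mem _ hf, ?_⟩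
          rw [← dist_smul g (g⁻¹ • o), ← dist_smul g o, ← dist_smul g (g⁻¹ • o)] at h
          simp only [← mul_smul, mul_inv_cancel, one_smul] at h ⊢
          rw [← mul_assoc] at h
          linarith) c
      obtain ⟨f, hf, rfl⟩ := Finset.mem_image.1 hf'
      exact ⟨f, hf, hc⟩
    have h1 := hν.measureReal_univ_le_of_cover hω hN (g • o) F (fun f => g * f * g⁻¹)
      (fun f hf => Subgroup.Normal.conj_mem ‹_› f (hFN f hf) g) hs hcover
    have h2 : ∀ f : G, dist ((g * f * g⁻¹) • g • o) (g • o) = dist (f • o) o := by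
      intro f
      rw [← mul_smul, inv_mul_cancel_right, mul_smul, dist_smul]
    simp only [h2] at h1
    have h3 := hν.measureReal_le_exp_dist hω (g • o) o hs
    rw [dist_comm] at h3
    rw [neg_mul, Real.exp_neg, ← div_eq_mul_inv, div_le_iff₀ (Real.exp_pos _),
      inv_mul_le_iff₀ (by positivity)]
    calc (ν (g • o)).real Set.univ ≤ Λ * (ν (g • o)).real s := h1
      _ ≤ (1 + Λ) * (ν (g • o)).real s := by
        gcongr
        linarith
      _ ≤ (1 + Λ) * (Real.exp (ω * dist o (g • o)) * (ν o).real s) := by gcongr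
      _ = _ := by ring
  exact ⟨fun r hr g => ⟨hlower g r hr, hν.measureReal_horoShadow_le hω o (g • o) r⟩, hlower⟩
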